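/- A two-way nondeterministic finite automaton (2NFA) over a finite alphabet $\Sigma$ has a finite set of states $Q$, a set of initial states $Q_0 \subseteq Q$, a set of accepting states $F \subseteq Q$, and a transition function $\delta \colon Q \times (\Sigma \cup \{\vdash, \dashv\}) \to \mathcal{P}(Q \times \{-1,+1\})$, where $\vdash, \dashv \notin \Sigma$ are end-markers and $\delta(q, \dashv) = \emptyset$ for all $q \in F$. On an input $w = a_1 \ldots a_\ell \in \Sigma^*$, with $a_0 = {\vdash}$ and $a_{\ell+1} = {\dashv}$, a computation is a maximal (finite or infinite) sequence of pairs $(p_i, k_i)$ with $p_i \in Q$ and $0 \leqslant k_i \leqslant \ell+1$, such that $p_0 \in Q_0$, $k_0 = 0$, and $(p_{i+1}, k_{i+1} - k_i) \in \delta(p_i, a_{k_i})$ for all $i$. It is accepting if it is finite and its last pair $(p, k)$ satisfies $p \in F$ and $k = \ell+1$. The language recognized by the 2NFA is the set of strings on which it has at least one accepting computation. Theorem. Let $\mathcal{A}$ be a 2NFA with $n$ states over an alphabet $\Sigma$, and let $L$ be the language it recognizes. Let $X = \{x_1, \dots, x_\ell\}$ and $Y = \{y_1, \dots, y_m\}$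 be finite sets of strings over $\Sigma$. Let $M$ be the $\ell \times m$ matrix defined by $M_{i,j} = 1$ if $x_i y_j \in L$, and $M_{i,j} = 0$ otherwise. Then $$\operatorname{rank} M \leqslant \sum_{k=1}^{n} (k-1)!\, k!\, S(n,k)\, S(n+1,k),$$ where the rank is taken over $\mathbb{Q}$ and $S(\cdot,\cdot)$ denotes the Stirling numbers of the second kind. -/

import Mathlib

/-- Tape symbols: the letters of the alphabet `α` together with two fresh end-markers. -/
inductive TapeSymbol (α : Type*) where
  | leftEnd : TapeSymbol α
  | letter (a : α) : TapeSymbol α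
  | rightEnd : TapeSymbol α

/-- Head moves: `left` is `-1`, `right` is `+1`. -/
inductive HeadMove where
  | left : HeadMove
  | right : HeadMove

/-- The displacement of the head. -/
def HeadMove.toInt : HeadMove → ℤ
  | HeadMove.left => -1
  | HeadMove.right => 1

/-- Two-way nondeterministic finite automata over the alphabet `α` with set of states `Q`.
Accepting states are effective at the right end-marker, where they have no transitions. -/
structure TwoWayNFA (α Q : Type*) where
  start : Set Q
  step : Q → TapeSymbol α → Set (Q × HeadMove)
  accept : Set Q
  step_accept : ∀ q ∈ accept, step q TapeSymbol.rightEnd = ∅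

/-- The input string `w = a₁ … a_ℓ` delimited by the end-markers; position `0` holds the left
end-marker, position `i` holds `a_i`, and position `ℓ + 1` holds the right end-marker. -/
def delimitedTape {α : Type*} (w : List α) : List (TapeSymbol α) :=
  TapeSymbol.leftEnd :: (w.map TapeSymbol.letter ++ [TapeSymbol.rightEnd])

namespace TwoWayNFA

/-- One step between configurations (state, head position) on the input `w`;
the head never leaves the delimited tape. -/
def StepRel {α Q : Type*} (A : TwoWayNFA α Q) (w : List α) (c d : Q × ℕ) : Prop :=
  ∃ (a : TapeSymbol α) (m : HeadMove),
    (delimitedTape w)[c.2]? = some a ∧ (d.1, m) ∈ A.step c.1 a ∧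
      (d.2 : ℤ) = (c.2 : ℤ) + m.toInt ∧ d.2 ≤ w.length + 1

/-- A finite computation with `t` steps that is accepting: it starts in an initial
configuration, follows the transitions, is maximal, and its last configuration is an accepting
state at the right end-marker. -/
structure IsAcceptingComputation {α Q : Type*} (A : TwoWayNFA α Q) (w : List α) (t : ℕ)
    (c : Fin (t + 1) → Q × ℕ) : Prop where
  start_mem : (c 0).1 ∈ A.start
  start_pos : (c 0).2 = 0
  step_rel : ∀ i : Fin t, A.StepRel w (c i.castSucc) (c i.succ)
  maximal : ∀ d : Q × ℕ, ¬ A.StepRel w (c (Fin.last t)) d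
  accept_mem : (c (Fin.last t)).1 ∈ A.accept
  accept_pos : (c (Fin.last t)).2 = w.length + 1

/-- The language recognized by the automaton. -/
def language {α Q : Type*} (A : TwoWayNFA α Q) : Language α :=
  {w | ∃ (t : ℕ) (c : Fin (t + 1) → Q × ℕ), A.IsAcceptingComputation w t c}

end TwoWayNFA

open Classical in
/-- The 0/1 matrix whose entry at `(i, j)` is `1` exactly when `x_i y_j ∈ L`. -/
noncomputable def concatMatrix {α : Type*} (L : Language α) {l m : ℕ}
    (x : Fin l → List α) (y : Fin m → List α) : Matrix (Fin l) (Fin m) ℚ :=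
  Matrix.of fun i j => if x i ++ y j ∈ L then 1 else 0

/-!
Cut the input `x ++ y` between `x` and `y`. The states in which a computation can cross from `x` to
`y` having returned fewer than `i` times form a chain `X₀ ⊆ X₁ ⊆ ⋯` with `X₀ = ∅` and
`Xᵢ₊₁ = F (G Xᵢ)`, where the monotone map `F` depends only on `x` and `G` only on `y`, and `x ++ y`
is accepted if and only if some `Xᵢ` meets a set `T` depending only on `y`. If `m + 1` is the first
such `i`, the chain is strictly increasing up to `Xₘ₊₁`.

Guess `m` and the two chains `Bᵢ = Xᵢ` and `Aᵢ = G Xᵢ`. Acceptance means that exactly one guess is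
correct, and correctness is the conjunction of a condition `Bᵢ₊₁ = F Aᵢ` on `x` and a condition on
`y`. So the matrix is a sum, over the guesses, of products of a vector indexed by `x` and one
indexed by `y`, and its rank is at most the dimension of the span of the former.

A chain is coded by labelling each state with the index at which it enters the chain. The labels of
`B` miss at most the last value, which marks the states that never enter, and then the vector of `x`
vanishes unless the same is true of the labels of `A`. It also vanishes if `F ∅` is empty. Otherwise
some state `q` can be added to or removed from every `Aᵢ` without affecting `F Aᵢ`, namely the state
in which `x` is about to be left for the first time, so the alternating sum of the vectors over all
ways of moving states to the last label is zero. This expresses each vector through those for which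
the labels of `A` are surjective. The surjective labels of `A` and the admissible labels of `B` are
counted by `(m + 1)! * S(n, m + 1)` and `(m + 1)! * S(n + 1, m + 2)`, and summing the products over
`m` gives the bound.
-/

section Counting

open Finset

variable {Q β : Type*} [Fintype β] [DecidableEq β]

theorem card_fin_succ_filter_image_eq {n : ℕ} (s : Finset β) :
    #{f : Fin (n + 1) → β | univ.image f = s} =
      ∑ x ∈ s, (#{f : Fin n → β | univ.image f = s} +
        #{f : Fin n → β | univ.image f = s.erase x}) := by
  have image_cons (x : β) (f : Fin n → β) :
      univ.image (Fin.cons x f : Fin (n + 1) → β) = insert x (univ.image f) := by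
    ext y
    simp [Fin.exists_fin_succ, eq_comm]
  have card_fiber (x : β) (hx : x ∈ s) : #{f : Fin n → β | insert x (univ.image f) = s} =
      #{f : Fin n → β | univ.image f = s} + #{f : Fin n → β | univ.image f = s.erase x} := by
    rw [← card_union_of_disjoint, ← filter_or]
    · refine congrArg card (filter_congr fun f _ => ⟨fun h => ?_, ?_⟩)
      · by_cases hxf : x ∈ univ.image f
        · exact Or.inl (by rwa [insert_eq_of_mem hxf] at h)
        · exact Or.inr (by rw [← h, erase_insert hxf])
      · rintro (h | h) <;> simp [h, hx]
    · refine disjoint_filter.2 fun f _ h h' => notMem_erase x s ?_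
      rwa [← h', h]
  have fiber_eq_empty (x : β) (hx : x ∉ s) :
      #{f : Fin n → β | insert x (univ.image f) = s} = 0 :=
    card_filter_eq_zero_iff.2 fun f _ h => hx (h ▸ mem_insert_self _ _)
  calc #{f : Fin (n + 1) → β | univ.image f = s}
      = ∑ x, #{f : Fin n → β | insert x (univ.image f) = s} := by
        simp only [card_filter]
        rw [← (Fin.consEquiv fun _ => β).sum_comp, Fintype.sum_prod_type]
        simp only [Fin.consEquiv, Equiv.coe_fn_mk, image_cons]
    _ = ∑ x ∈ s, #{f : Fin n → β | insert x (univ.image f) = s} :=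
        (sum_subset (subset_univ s) fun x _ => fiber_eq_empty x).symm
    _ = _ := sum_congr rfl card_fiber

theorem card_fin_filter_image_eq (n : ℕ) (s : Finset β) :
    #{f : Fin n → β | univ.image f = s} = (#s).factorial * Nat.stirlingSecond n #s := by
  induction n generalizing s with
  | zero =>
    rcases s.eq_empty_or_nonempty with rfl | hs
    · simp
    · obtain ⟨k, hk⟩ := Nat.exists_eq_succ_of_ne_zero hs.card_ne_zero
      simp [hk, hs.ne_empty.symm]
  | succ n ih =>
    rw [card_fin_succ_filter_image_eq]
    rcases s.eq_empty_or_nonempty with rfl | hs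
    · simp
    · obtain ⟨k, hk⟩ := Nat.exists_eq_succ_of_ne_zero hs.card_ne_zero
      have summand (x : β) (hx : x ∈ s) : #{f : Fin n → β | univ.image f = s} +
          #{f : Fin n → β | univ.image f = s.erase x} =
            (k + 1).factorial * Nat.stirlingSecond n (k + 1) +
              k.factorial * Nat.stirlingSecond n k := by
        rw [ih, ih, card_erase_of_mem hx, hk, Nat.succ_eq_add_one, Nat.add_sub_cancel]
      rw [sum_congr rfl summand, sum_const, hk, Nat.succ_eq_add_one,
        Nat.stirlingSecond_succ_succ, Nat.factorial_succ, smul_eq_mul]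
      ring

variable [Fintype Q]

/-- Functions to `Fin (k + 1)` that take every value, except possibly the last one. They encode
the strictly increasing chains of `k` nonempty subsets of `Q`, the `i`-th subset being the set of
points with value below `i`. -/
abbrev AlmostSurjection (Q : Type*) (k : ℕ) : Type _ :=
  {f : Q → Fin (k + 1) // ∀ i : Fin k, i.castSucc ∈ Set.range f}

theorem card_le_of_almostSurjection {k : ℕ} (f : AlmostSurjection Q k) : k ≤ Fintype.card Q := by
  choose q hq using f.2
  have hinj : Function.Injective q := fun i j hij =>
    Fin.castSucc_injective k (by rw [← hq i, ← hq j, hij])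
  simpa using Fintype.card_le_of_injective q hinj

variable [DecidableEq Q]

theorem card_filter_image_eq (s : Finset β) :
    #{f : Q → β | univ.image f = s} =
      (#s).factorial * Nat.stirlingSecond (Fintype.card Q) #s := by
  rw [← card_fin_filter_image_eq]
  refine card_equiv ((Fintype.equivFin Q).arrowCongr (Equiv.refl β)) fun f => ?_
  have image_comp : univ.image (f ∘ (Fintype.equivFin Q).symm) = univ.image f := by
    rw [← image_image, image_univ_equiv]
  simp only [mem_filter, mem_univ, true_and]
  change univ.image f = s ↔ univ.image (f ∘ (Fintype.equivFin Q).symm) = s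
  rw [image_comp]

theorem card_surjective_fin (k : ℕ) :
    Fintype.card {f : Q → Fin k // Function.Surjective f} =
      k.factorial * Nat.stirlingSecond (Fintype.card Q) k := by
  rw [Fintype.card_of_subtype {f : Q → Fin k | univ.image f = univ}
    (by simp [eq_univ_iff_forall, Function.Surjective]), card_filter_image_eq, card_univ,
    Fintype.card_fin]

theorem card_almostSurjection (k : ℕ) :
    Fintype.card (AlmostSurjection Q k) =
      k.factorial * Nat.stirlingSecond (Fintype.card Q + 1) (k + 1) := by
  have misses_only_last (f : Q → Fin (k + 1)) : (∀ i : Fin k, i.castSucc ∈ Set.range f) ↔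
      univ.image f = univ ∨ univ.image f = univ.erase (Fin.last k) := by
    constructor
    · intro h
      by_cases hl : Fin.last k ∈ univ.image f
      · left
        refine eq_univ_of_forall fun j => ?_
        cases j using Fin.lastCases with
        | last => exact hl
        | cast i => simpa using h i
      · right
        ext j
        cases j using Fin.lastCases with
        | last => simp [hl]
        | cast i => simpa [Fin.castSucc_ne_last] using h i
    · intro h i
      have : i.castSucc ∈ univ.image f := by
        rcases h with h | h <;> simp [h, Fin.castSucc_ne_last]
      simpa using this
  have univ_ne_erase : univ ≠ univ.erase (Fin.last k) := fun h =>
    notMem_erase (Fin.last k) univ (h ▸ mem_univ _)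
  rw [Fintype.card_subtype]
  simp only [misses_only_last, filter_or]
  rw [card_union_of_disjoint (disjoint_filter.2 fun f _ h h' => univ_ne_erase (h.symm.trans h')),
     card_filter_image_eq, card_filter_image_eq,
    card_erase_of_mem (mem_univ _), card_univ, Fintype.card_fin, Nat.add_sub_cancel,
    Nat.stirlingSecond_succ_succ, Nat.factorial_succ]
  ring

theorem sum_range_mul_add_succ (g : ℕ → ℕ) (n : ℕ) :
    ∑ m ∈ range n, g (m + 1) * (g (m + 2) + g (m + 1)) + g 0 * g 1 =
      ∑ m ∈ range n, g (m + 1) * (g (m + 1) + g m) + g n * g (n + 1) := by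
  induction n with
  | zero => simp
  | succ n ih =>
    simp only [sum_range_succ]
    linarith

theorem sum_factorial_mul_stirlingSecond (n : ℕ) :
    ∑ m ∈ range n, ((m + 1).factorial * Nat.stirlingSecond n (m + 1)) *
        ((m + 1).factorial * Nat.stirlingSecond (n + 1) (m + 2)) =
      ∑ k ∈ Icc 1 n, (k - 1).factorial * k.factorial * Nat.stirlingSecond n k *
        Nat.stirlingSecond (n + 1) k := by
  -- The recurrence for `S(n + 1, ·)` turns the left summand into
  -- `g (m + 1) * (g (m + 2) + g (m + 1))` and the right one, at `k = m + 1`, into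
  -- `g (m + 1) * (g (m + 1) + g m)`.
  set g : ℕ → ℕ := fun k => k.factorial * Nat.stirlingSecond n k with hg
  have boundary : g 0 * g 1 = g n * g (n + 1) := by
    cases n <;> simp [hg, Nat.stirlingSecond_eq_zero_of_lt]
  have hsum := sum_range_mul_add_succ g n
  rw [boundary, Nat.add_right_cancel_iff] at hsum
  rw [← Ico_add_one_right_eq_Icc, sum_Ico_eq_sum_range, Nat.add_sub_cancel]
  convert hsum using 2 with m _ m _
  · simp only [hg, Nat.stirlingSecond_succ_succ, Nat.factorial_succ]
    ring
  · rw [add_comm 1 m]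
    simp only [hg, Nat.stirlingSecond_succ_succ, Nat.factorial_succ, Nat.add_sub_cancel]
    ring

end Counting

section Levels

variable {Q : Type*} {k : ℕ}

/-- The points where `f` takes a value below `i`. A function `f : Q → Fin (k + 1)` is used as a code
for the chain of its sublevel sets with `i ≤ k`; the value `Fin.last k` marks the points outside all
of them. -/
def sublevel (f : Q → Fin k) (i : ℕ) : Set Q :=
  {q | (f q : ℕ) < i}

theorem mem_sublevel {f : Q → Fin k} {i : ℕ} {q : Q} : q ∈ sublevel f i ↔ (f q : ℕ) < i :=
  Iff.rfl

theorem sublevel_zero (f : Q → Fin k) : sublevel f 0 = ∅ := by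
  simp [sublevel]

theorem sublevel_succ_eq_iff {f : Q → Fin k} {i : Fin k} :
    sublevel f (i + 1) = sublevel f i ↔ i ∉ Set.range f := by
  simp only [Set.ext_iff, mem_sublevel, Set.mem_range, not_exists, Fin.ext_iff]
  exact forall_congr' fun q => by omega

theorem eq_of_sublevel_eq {f g : Q → Fin (k + 1)}
    (h : ∀ i ≤ k, sublevel f i = sublevel g i) : f = g := by
  have lt_iff (q : Q) (i : ℕ) (hi : i ≤ k) : (f q : ℕ) < i ↔ (g q : ℕ) < i :=
    Set.ext_iff.1 (h i hi) q
  funext q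
  by_contra hne
  rcases Fin.lt_or_lt_of_ne hne with hlt | hlt
  · exact lt_irrefl _ ((lt_iff q (g q) (by omega)).1 hlt)
  · exact lt_irrefl _ ((lt_iff q (f q) (by omega)).2 hlt)

theorem exists_sublevel_eq (k : ℕ) {S : ℕ → Set Q} (hS : Monotone S) (hS0 : S 0 = ∅) :
    ∃ f : Q → Fin (k + 1), ∀ i ≤ k, sublevel f i = S i := by
  classical
  refine ⟨fun q => ⟨Nat.findGreatest (fun i => q ∉ S i) k,
    Nat.lt_succ_of_le (Nat.findGreatest_le k)⟩, fun i hi => Set.ext fun q => ?_⟩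
  have not_mem_findGreatest : q ∉ S (Nat.findGreatest (fun i => q ∉ S i) k) :=
    Nat.findGreatest_spec (P := fun i => q ∉ S i) (Nat.zero_le k) (by simp [hS0])
  rw [mem_sublevel, ← not_le]
  refine ⟨fun h => ?_, fun hq hle => not_mem_findGreatest (hS hle hq)⟩
  by_contra hq
  exact h (Nat.le_findGreatest hi hq)

theorem iterate_ne_iterate_succ_of_isLeast {β : Type*} {f : β → β} {x : β} {p : β → Prop} {k : ℕ}
    (hk : IsLeast {i | p (f^[i] x)} k) {i : ℕ} (hi : i < k) : f^[i + 1] x ≠ f^[i] x := by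
  intro h
  rw [Function.iterate_succ_apply'] at h
  have hki : f^[k] x = f^[i] x := by
    rw [← Nat.sub_add_cancel hi.le, Function.iterate_add_apply, Function.iterate_fixed h]
  exact hi.not_ge (hk.2 (hki ▸ hk.1 : p (f^[i] x)))

end Levels

section Labellings

variable {Q : Type*} {m : ℕ} {F G : Set Q → Set Q} {T : Set Q}
  {a : Q → Fin (m + 1)} {b : Q → Fin (m + 2)}

/-- The labels `a` and `b` code chains `A₀ ⊆ ⋯ ⊆ Aₘ` and `B₀ ⊆ ⋯ ⊆ Bₘ₊₁` with `Bᵢ₊₁ = F Aᵢ`. -/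
def PrefixCompatible (F : Set Q → Set Q) (a : Q → Fin (m + 1)) (b : Q → Fin (m + 2)) : Prop :=
  ∀ i ≤ m, sublevel b (i + 1) = F (sublevel a i)

/-- The labels `a` and `b` code chains `A₀ ⊆ ⋯ ⊆ Aₘ` and `B₀ ⊆ ⋯ ⊆ Bₘ₊₁` with `Aᵢ = G Bᵢ`, and
`Bₘ₊₁` is the first member of its chain that meets `T`. -/
def SuffixCompatible (G : Set Q → Set Q) (T : Set Q) (a : Q → Fin (m + 1)) (b : Q → Fin (m + 2)) :
    Prop :=
  (∀ i ≤ m, sublevel a i = G (sublevel b i)) ∧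
    Disjoint (sublevel b m) T ∧ ¬Disjoint (sublevel b (m + 1)) T

theorem sublevel_eq_iterate (hF : PrefixCompatible F a b) (hG : SuffixCompatible G T a b)
    {i : ℕ} (hi : i ≤ m + 1) : sublevel b i = (F ∘ G)^[i] ∅ := by
  induction i with
  | zero => exact sublevel_zero b
  | succ i ih =>
    rw [Function.iterate_succ_apply', Function.comp_apply, ← ih (by omega), ← hG.1 i (by omega),
      hF i (by omega)]

theorem monotone_iterate_empty {f : Set Q → Set Q} (hf : Monotone f) :
    Monotone fun i => f^[i] ∅ :=
  hf.monotone_iterate_of_le_map (Set.empty_subset _)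

theorem isLeast_of_compatible (hFG : Monotone (F ∘ G)) (hF : PrefixCompatible F a b)
    (hG : SuffixCompatible G T a b) : IsLeast {i | ¬Disjoint ((F ∘ G)^[i] ∅) T} (m + 1) := by
  have ⟨_, hdisj, hmeets⟩ := hG
  rw [sublevel_eq_iterate hF hG le_rfl] at hmeets
  refine ⟨hmeets, fun i hi => ?_⟩
  by_contra! hlt
  rw [sublevel_eq_iterate hF hG (by omega)] at hdisj
  exact hi (hdisj.mono_left (monotone_iterate_empty hFG (by omega)))

theorem exists_compatible (hF : Monotone F) (hG : Monotone G) (hG0 : G ∅ = ∅)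
    (hm : IsLeast {i | ¬Disjoint ((F ∘ G)^[i] ∅) T} (m + 1)) :
    ∃ (a : Q → Fin (m + 1)) (b : AlmostSurjection Q (m + 1)),
      PrefixCompatible F a b.1 ∧ SuffixCompatible G T a b.1 := by
  have hmono : Monotone fun i => (F ∘ G)^[i] ∅ := monotone_iterate_empty (hF.comp hG)
  obtain ⟨b, hb⟩ := exists_sublevel_eq (m + 1) hmono rfl
  obtain ⟨a, ha⟩ := exists_sublevel_eq m (hG.comp hmono) hG0
  have hb_range (i : Fin (m + 1)) : i.castSucc ∈ Set.range b := by
    by_contra hi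
    have heq := sublevel_succ_eq_iff.2 hi
    rw [Fin.val_castSucc, hb _ (by omega), hb _ (by omega)] at heq
    exact iterate_ne_iterate_succ_of_isLeast (p := fun X => ¬Disjoint X T) hm i.2 heq
  refine ⟨a, ⟨b, hb_range⟩, fun i hi => ?_, fun i hi => ?_, ?_, ?_⟩
  · rw [ha i hi, hb (i + 1) (by omega)]
    exact Function.iterate_succ_apply' ..
  · rw [ha i hi, hb i (by omega)]
    rfl
  · rw [hb m (by omega)]
    by_contra hdisj
    exact absurd (hm.2 hdisj) (by omega)
  · rw [hb (m + 1) le_rfl]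
    exact hm.1

/-- The pairs of labels that can occur for a given pair of prefix and suffix: the number `m` of
returns from the suffix, the labels `a` of the states crossing leftwards and the labels `b` of the
states crossing rightwards. -/
abbrev Labelling (Q : Type*) [Fintype Q] : Type _ :=
  Σ m : Fin (Fintype.card Q), (Q → Fin (m + 1)) × AlmostSurjection Q (m + 1)

theorem existsUnique_labelling [Fintype Q] (hF : Monotone F) (hG : Monotone G) (hG0 : G ∅ = ∅)
    (h : ∃ i, ¬Disjoint ((F ∘ G)^[i] ∅) T) :
    ∃! σ : Labelling Q,
      SuffixCompatible G T σ.2.1 σ.2.2.1 ∧ PrefixCompatible F σ.2.1 σ.2.2.1 := by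
  classical
  obtain ⟨m, hm⟩ : ∃ m, IsLeast {i | ¬Disjoint ((F ∘ G)^[i] ∅) T} (m + 1) := by
    have hfind : IsLeast {i | ¬Disjoint ((F ∘ G)^[i] ∅) T} (Nat.find h) := Nat.isLeast_find h
    obtain ⟨m, hm⟩ := Nat.exists_eq_succ_of_ne_zero (n := Nat.find h) fun h0 =>
      (h0 ▸ hfind.1) (Set.empty_disjoint T)
    exact ⟨m, by rwa [hm] at hfind⟩
  obtain ⟨a, b, hFab, hGab⟩ := exists_compatible hF hG hG0 hm
  refine ⟨⟨⟨m, card_le_of_almostSurjection b⟩, a, b⟩, ⟨hGab, hFab⟩, ?_⟩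
  rintro ⟨⟨m', hm'⟩, a', b'⟩ ⟨hGab', hFab'⟩
  obtain rfl : m' = m :=
    Nat.succ_injective ((isLeast_of_compatible (hF.comp hG) hFab' hGab').unique hm)
  obtain rfl : b' = b := Subtype.ext <| eq_of_sublevel_eq fun i hi => by
    rw [sublevel_eq_iterate hFab hGab hi, sublevel_eq_iterate hFab' hGab' hi]
  obtain rfl : a' = a := eq_of_sublevel_eq fun i hi => by rw [hGab.1 i hi, hGab'.1 i hi]
  rfl

theorem PrefixCompatible.mem_range (h : PrefixCompatible F a b)
    (hb : ∀ i : Fin (m + 1), i.castSucc ∈ Set.range b) (i : Fin m) :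
    i.castSucc ∈ Set.range a := by
  by_contra hi
  refine sublevel_succ_eq_iff.not_left.2 (hb i.succ) ?_
  have heq := sublevel_succ_eq_iff.2 hi
  rw [Fin.val_castSucc] at heq
  rw [Fin.val_castSucc, Fin.val_succ, h _ (by omega), h _ (by omega), heq]

open Classical in
/-- The points of `D` get the last label, which removes them from the coded chain. -/
noncomputable def eraseLabels (a : Q → Fin (m + 1)) (D : Finset Q) : Q → Fin (m + 1) :=
  fun q => if q ∈ D then Fin.last m else a q

theorem sublevel_eraseLabels (a : Q → Fin (m + 1)) (D : Finset Q) {i : ℕ} (hi : i ≤ m) :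
    sublevel (eraseLabels a D) i = sublevel a i \ D := by
  ext q
  by_cases hq : q ∈ D <;> simp [mem_sublevel, eraseLabels, hq, hi]

theorem prefixCompatible_eraseLabels_insert_iff [DecidableEq Q] {q : Q}
    (hq : ∀ Y, F (insert q Y) = F Y) (D : Finset Q) :
    PrefixCompatible F (eraseLabels a (insert q D)) b ↔ PrefixCompatible F (eraseLabels a D) b := by
  refine forall₂_congr fun i hi => ?_
  rw [sublevel_eraseLabels a _ hi, sublevel_eraseLabels a _ hi, ← hq, ← hq (_ \ (D : Set Q)),
    Finset.coe_insert, ← Set.union_singleton (s := (D : Set Q)), ← Set.sdiff_sdiff,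
    Set.insert_sdiff_singleton]

theorem not_prefixCompatible_of_map_empty (hF : F ∅ = ∅) (hb : (0 : Fin (m + 2)) ∈ Set.range b) :
    ¬PrefixCompatible F a b := by
  intro h
  obtain ⟨r, hr⟩ := hb
  have hr_mem : r ∈ sublevel b (0 + 1) := by simp [mem_sublevel, hr]
  rw [h 0 (Nat.zero_le m), sublevel_zero, hF] at hr_mem
  exact hr_mem

end Labellings

section Rank

open Finset

variable {Q ι κ : Type*} {m : ℕ}

theorem sum_neg_one_pow_card_smul_eq_zero {M : Type*} [AddCommGroup M] [Fintype Q] [DecidableEq Q]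
    (f : Finset Q → M) (q : Q) (hf : ∀ D, f (insert q D) = f D) :
    ∑ D, (-1 : ℤ) ^ #D • f D = 0 := by
  rw [← powerset_univ, ← insert_erase (mem_univ q), sum_powerset_insert (notMem_erase q _),
    ← sum_add_distrib]
  refine sum_eq_zero fun D hD => ?_
  have hq : q ∉ D := fun h => notMem_erase q _ (mem_powerset.1 hD h)
  rw [hf, card_insert_of_notMem hq, ← add_smul, pow_succ, mul_neg_one, add_neg_cancel, zero_smul]

open Classical in
/-- The column of the prefixes compatible with the labels `a` and `b`, where `F i` is the map of
the `i`-th prefix. -/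
noncomputable def prefixVector (K : Type*) [Field K] (F : ι → Set Q → Set Q) (a : Q → Fin (m + 1))
    (b : Q → Fin (m + 2)) : ι → K :=
  fun i => if PrefixCompatible (F i) a b then 1 else 0

variable {K : Type*} [Field K] {F : ι → Set Q → Set Q}

theorem prefixVector_eq_zero {a : Q → Fin (m + 1)} {b : AlmostSurjection Q (m + 1)} {k : Fin m}
    (hk : k.castSucc ∉ Set.range a) : prefixVector K F a b.1 = 0 :=
  funext fun _ => if_neg fun h => hk (h.mem_range b.2 k)

theorem sum_neg_one_pow_card_smul_prefixVector_eq_zero [Fintype Q]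
    (hF : ∀ i, F i ∅ = ∅ ∨ ∃ q, ∀ Y, F i (insert q Y) = F i Y) (a : Q → Fin (m + 1))
    (b : AlmostSurjection Q (m + 1)) :
    ∑ D, (-1 : ℤ) ^ #D • prefixVector K F (eraseLabels a D) b.1 = 0 := by
  classical
  ext i
  simp only [Finset.sum_apply, Pi.smul_apply, Pi.zero_apply]
  rcases hF i with hempty | ⟨q, hq⟩
  · refine sum_eq_zero fun D _ => ?_
    rw [prefixVector, if_neg (not_prefixCompatible_of_map_empty hempty (b.2 0)), smul_zero]
  · refine sum_neg_one_pow_card_smul_eq_zero _ q fun D => ?_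
    simp only [prefixVector, prefixCompatible_eraseLabels_insert_iff hq]

theorem prefixVector_eraseLabels_mem_span {a : Q → Fin (m + 1)} {b : AlmostSurjection Q (m + 1)}
    (ha : Fin.last m ∈ Set.range a) :
    prefixVector K F a b.1 ∈ Submodule.span K (Set.range
      fun a : {a : Q → Fin (m + 1) // Function.Surjective a} => prefixVector K F a.1 b.1) := by
  by_cases h : ∃ k : Fin m, k.castSucc ∉ Set.range a
  · obtain ⟨k, hk⟩ := h
    rw [prefixVector_eq_zero hk]
    exact Submodule.zero_mem _
  · push Not at h
    exact Submodule.subset_span ⟨⟨a, Fin.lastCases ha h⟩, rfl⟩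

theorem prefixVector_mem_span [Finite Q]
    (hF : ∀ i, F i ∅ = ∅ ∨ ∃ q, ∀ Y, F i (insert q Y) = F i Y) (a : Q → Fin (m + 1))
    (b : AlmostSurjection Q (m + 1)) :
    prefixVector K F a b.1 ∈ Submodule.span K (Set.range
      fun a : {a : Q → Fin (m + 1) // Function.Surjective a} => prefixVector K F a.1 b.1) := by
  classical
  cases nonempty_fintype Q
  -- The term at `D = ∅` is the given vector; all other labels take the last value.
  have hsum := sum_neg_one_pow_card_smul_prefixVector_eq_zero (K := K) hF a b
  have erase_empty : eraseLabels a ∅ = a := funext fun q => if_neg (notMem_empty q)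
  rw [← add_sum_erase _ _ (mem_univ ∅), card_empty, pow_zero, one_smul, erase_empty,
    add_eq_zero_iff_eq_neg] at hsum
  rw [hsum]
  refine Submodule.neg_mem _ (Submodule.sum_mem _ fun D hD => zsmul_mem ?_ _)
  obtain ⟨q, hq⟩ := nonempty_of_ne_empty (ne_of_mem_erase hD)
  exact prefixVector_eraseLabels_mem_span ⟨q, by simp [eraseLabels, hq]⟩

open Classical in
theorem ite_exists_not_disjoint_eq_sum {F G : Set Q → Set Q} {T : Set Q} [Fintype Q]
    (hF : Monotone F) (hG : Monotone G) (hG0 : G ∅ = ∅) :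
    (if ∃ i, ¬Disjoint ((F ∘ G)^[i] ∅) T then (1 : K) else 0) =
      ∑ σ : Labelling Q, (if SuffixCompatible G T σ.2.1 σ.2.2.1 then 1 else 0) *
        (if PrefixCompatible F σ.2.1 σ.2.2.1 then 1 else 0) := by
  simp only [ite_zero_mul_ite_zero, mul_one, sum_boole]
  split_ifs with h
  · rw [(Fintype.existsUnique_iff_card_one _).1 (existsUnique_labelling hF hG hG0 h), Nat.cast_one]
  · rw [filter_false_of_mem, card_empty, Nat.cast_zero]
    exact fun σ _ hσ => h ⟨_, (isLeast_of_compatible (hF.comp hG) hσ.2 hσ.1).1⟩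

/-- The labellings whose leftward labels take every value. Inclusion–exclusion reduces all others to
these, and the bound on the rank is their number. -/
abbrev SurjectiveLabelling (Q : Type*) [Fintype Q] : Type _ :=
  Σ m : Fin (Fintype.card Q),
    {a : Q → Fin (m + 1) // Function.Surjective a} × AlmostSurjection Q (m + 1)

theorem card_surjectiveLabelling (Q : Type*) [Fintype Q] [DecidableEq Q] :
    Fintype.card (SurjectiveLabelling Q) =
      ∑ k ∈ Icc 1 (Fintype.card Q), (k - 1).factorial * k.factorial *
        Nat.stirlingSecond (Fintype.card Q) k * Nat.stirlingSecond (Fintype.card Q + 1) k := by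
  simp only [Fintype.card_sigma, Fintype.card_prod, card_surjective_fin, card_almostSurjection]
  rw [← sum_factorial_mul_stirlingSecond]
  exact Fin.sum_univ_eq_sum_range (fun m =>
    ((m + 1).factorial * Nat.stirlingSecond (Fintype.card Q) (m + 1)) *
      ((m + 1).factorial * Nat.stirlingSecond (Fintype.card Q + 1) (m + 2))) _

open Classical in
theorem indicator_column_mem_span [Fintype Q] {G : Set Q → Set Q} {T : Set Q}
    (hF : ∀ i, Monotone (F i)) (hG : Monotone G) (hG0 : G ∅ = ∅)
    (hF_redundant : ∀ i, F i ∅ = ∅ ∨ ∃ q, ∀ Y, F i (insert q Y) = F i Y) :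
    (fun i => if ∃ k, ¬Disjoint ((F i ∘ G)^[k] ∅) T then (1 : K) else 0) ∈
      Submodule.span K (Set.range fun σ : SurjectiveLabelling Q =>
        prefixVector K F σ.2.1.1 σ.2.2.1) := by
  have column_eq : (fun i => if ∃ k, ¬Disjoint ((F i ∘ G)^[k] ∅) T then (1 : K) else 0) =
      ∑ σ : Labelling Q, (if SuffixCompatible G T σ.2.1 σ.2.2.1 then (1 : K) else 0) •
        prefixVector K F σ.2.1 σ.2.2.1 := by
    ext i
    simp only [Finset.sum_apply, Pi.smul_apply, smul_eq_mul, prefixVector]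
    exact ite_exists_not_disjoint_eq_sum (hF i) hG hG0
  rw [column_eq]
  refine Submodule.sum_mem _ fun σ _ => Submodule.smul_mem _ _ ?_
  refine Submodule.span_mono ?_ (prefixVector_mem_span hF_redundant σ.2.1 σ.2.2)
  rintro _ ⟨a, rfl⟩
  exact ⟨⟨σ.1, a, σ.2.2⟩, rfl⟩

open Classical in
theorem rank_indicator_le [Finite ι] [Fintype κ] [Fintype Q] {G : κ → Set Q → Set Q}
    {T : κ → Set Q} (hF : ∀ i, Monotone (F i)) (hG : ∀ j, Monotone (G j)) (hG0 : ∀ j, G j ∅ = ∅)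
    (hF_redundant : ∀ i, F i ∅ = ∅ ∨ ∃ q, ∀ Y, F i (insert q Y) = F i Y) :
    (Matrix.of fun i j =>
      if ∃ k, ¬Disjoint ((F i ∘ G j)^[k] ∅) (T j) then (1 : K) else 0).rank ≤
      ∑ k ∈ Icc 1 (Fintype.card Q), (k - 1).factorial * k.factorial *
        Nat.stirlingSecond (Fintype.card Q) k * Nat.stirlingSecond (Fintype.card Q + 1) k := by
  rw [Matrix.rank_eq_finrank_span_cols, ← card_surjectiveLabelling]
  exact (Submodule.finrank_mono (Submodule.span_le.2 (Set.range_subset_iff.2 fun j =>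
    indicator_column_mem_span hF (hG j) (hG0 j) hF_redundant))).trans (finrank_range_le_card _)

end Rank

namespace TwoWayNFA

open Relation

variable {α Q : Type*} (A : TwoWayNFA α Q)

section Language

variable {w : List α}

theorem reflTransGen_iff_exists_sequence {β : Type*} {r : β → β → Prop} {a b : β} :
    ReflTransGen r a b ↔ ∃ (t : ℕ) (c : Fin (t + 1) → β), c 0 = a ∧ c (Fin.last t) = b ∧
      ∀ i : Fin t, r (c i.castSucc) (c i.succ) := by
  constructor
  · intro h
    induction h with
    | refl => exact ⟨0, fun _ => a, rfl, rfl, fun i => i.elim0⟩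
    | @tail b d _ hbd ih =>
      obtain ⟨t, c, hfirst, hlast, hc⟩ := ih
      refine ⟨t + 1, Fin.snoc c d, ?_, Fin.snoc_last _ _, fun i => ?_⟩
      · rw [← Fin.castSucc_zero, Fin.snoc_castSucc, hfirst]
      · rw [Fin.snoc_castSucc]
        cases i using Fin.lastCases with
        | last => rwa [Fin.succ_last, Fin.snoc_last, hlast]
        | cast i =>
          rw [Fin.succ_castSucc, Fin.snoc_castSucc]
          exact hc i
  · rintro ⟨t, c, rfl, rfl, hc⟩
    induction Fin.last t using Fin.induction with
    | zero => exact .refl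
    | succ i ih => exact ih.tail (hc i)

theorem not_stepRel_of_mem_accept {f : Q} (hf : f ∈ A.accept) (d : Q × ℕ) :
    ¬A.StepRel w (f, w.length + 1) d := by
  rintro ⟨a, m, ha, hm, -⟩
  obtain rfl : TapeSymbol.rightEnd = a := by
    simpa [delimitedTape, List.getElem?_append_right] using ha
  rw [A.step_accept f hf] at hm
  exact hm

theorem mem_language_iff :
    w ∈ A.language ↔ ∃ s ∈ A.start, ∃ f ∈ A.accept,
      ReflTransGen (A.StepRel w) (s, 0) (f, w.length + 1) := by
  simp only [reflTransGen_iff_exists_sequence]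
  constructor
  · rintro ⟨t, c, hc⟩
    exact ⟨_, hc.start_mem, _, hc.accept_mem, t, c, Prod.ext rfl hc.start_pos,
      Prod.ext rfl hc.accept_pos, hc.step_rel⟩
  · rintro ⟨s, hs, f, hf, t, c, hfirst, hlast, hc⟩
    exact ⟨t, c, by rwa [hfirst], by rw [hfirst], hc,
      fun d => hlast ▸ A.not_stepRel_of_mem_accept hf d, by rwa [hlast], by rw [hlast]⟩

end Language

section Steps

variable {A} {x y w : List α} {c d : Q × ℕ}

theorem StepRel.move_le_one (h : A.StepRel w c d) : d.2 ≤ c.2 + 1 ∧ c.2 ≤ d.2 + 1 := by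
  obtain ⟨-, m, -, -, hd, -⟩ := h
  cases m <;> simp only [HeadMove.toInt] at hd <;> omega

theorem delimitedTape_append_getElem?_of_le {k : ℕ} (hk : k ≤ x.length) :
    (delimitedTape (x ++ y))[k]? = (delimitedTape x)[k]? := by
  rcases k with _ | k
  · rfl
  · simp [delimitedTape, List.getElem?_append_left, Nat.lt_of_succ_le hk]

theorem delimitedTape_append_getElem?_add (x y : List α) (k : ℕ) :
    (delimitedTape (x ++ y))[x.length + (k + 1)]? = (delimitedTape y)[k + 1]? := by
  have h : (y.map TapeSymbol.letter ++ [TapeSymbol.rightEnd])[k]? =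
      ((x ++ y).map TapeSymbol.letter ++ [TapeSymbol.rightEnd])[x.length + k]? := by
    simp [List.getElem?_append_right]
  exact h.symm

theorem stepRel_append_iff_of_le (hc : c.2 ≤ x.length) :
    A.StepRel (x ++ y) c d ↔ A.StepRel x c d := by
  rw [StepRel, StepRel, delimitedTape_append_getElem?_of_le hc]
  refine exists₂_congr fun a m => and_congr_right fun _ => and_congr_right fun _ =>
    and_congr_right fun hd => ?_
  rw [List.length_append]
  cases m <;> simp only [HeadMove.toInt] at hd <;> omega

theorem stepRel_append_add_iff {p q : Q} {k j : ℕ} :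
    A.StepRel (x ++ y) (p, x.length + (k + 1)) (q, x.length + j) ↔
      A.StepRel y (p, k + 1) (q, j) := by
  simp only [StepRel, delimitedTape_append_getElem?_add, List.length_append]
  refine exists₂_congr fun a m => and_congr_right fun _ => and_congr_right fun _ => ?_
  push_cast
  constructor <;> rintro ⟨h, h'⟩ <;> constructor <;> omega

end Steps

section Crossings

/-- A step of `A` on `x` that does not read the right end-marker. On inputs starting with `x`, these
are the steps from the positions up to `|x|`; position `|x| + 1` stands for having left `x`. -/
def PrefixStep (x : List α) (c d : Q × ℕ) : Prop :=
  c.2 ≤ x.length ∧ A.StepRel x c d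

/-- A step of `A` on `y` that does not read the left end-marker. On an input `x ++ y`, these are the
steps from the positions after `|x|`, shifted by `|x|`; position `0` stands for having left `y`. -/
def SuffixStep (y : List α) (c d : Q × ℕ) : Prop :=
  1 ≤ c.2 ∧ A.StepRel y c d

/-- The configurations reachable inside the prefix `x`, from the start or from an entry at the last
position of `x` in a state of `Y`. -/
def prefixReach (x : List α) (Y : Set Q) : Set (Q × ℕ) :=
  {d | ∃ c : Q × ℕ, (c.1 ∈ A.start ∧ c.2 = 0 ∨ c.1 ∈ Y ∧ c.2 = x.length) ∧
    ReflTransGen (A.PrefixStep x) c d}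

/-- The configurations reachable inside the suffix `y`, from an entry at the first position after
the prefix in a state of `X`. -/
def suffixReach (y : List α) (X : Set Q) : Set (Q × ℕ) :=
  {d | ∃ r ∈ X, ReflTransGen (A.SuffixStep y) (r, 1) d}

/-- The states in which `A` can leave the prefix `x` when it may enter it from the right in the
states of `Y`. -/
def prefixMap (x : List α) (Y : Set Q) : Set Q :=
  {r | (r, x.length + 1) ∈ A.prefixReach x Y}

/-- The states in which `A` can leave the suffix `y` to the left when it may enter it in the states
of `X`. -/
def suffixMap (y : List α) (X : Set Q) : Set Q :=
  {q | (q, 0) ∈ A.suffixReach y X}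

/-- The states from which `A`, entering the suffix `y`, can accept without leaving it. -/
def acceptingEntries (y : List α) : Set Q :=
  {r | ∃ f ∈ A.accept, ReflTransGen (A.SuffixStep y) (r, 1) (f, y.length + 1)}

variable {A} {x y : List α} {c d : Q × ℕ}

theorem prefixReach_mono (x : List α) : Monotone (A.prefixReach x) :=
  fun _ _ h _ ⟨c, hc, hcd⟩ => ⟨c, hc.imp_right (And.imp_left (h ·)), hcd⟩

theorem suffixReach_mono (y : List α) : Monotone (A.suffixReach y) :=
  fun _ _ h _ ⟨r, hr, hrd⟩ => ⟨r, h hr, hrd⟩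

theorem prefixMap_mono (x : List α) : Monotone (A.prefixMap x) :=
  fun _ _ h _ hr => prefixReach_mono x h hr

theorem suffixMap_mono (y : List α) : Monotone (A.suffixMap y) :=
  fun _ _ h _ hq => suffixReach_mono y h hq

theorem suffixMap_empty (y : List α) : A.suffixMap y ∅ = ∅ :=
  Set.eq_empty_of_forall_notMem fun _ ⟨_, hr, _⟩ => hr

theorem prefixReach_insert {q : Q} {Y : Set Q} (hq : (q, x.length) ∈ A.prefixReach x Y) :
    A.prefixReach x (insert q Y) = A.prefixReach x Y := by
  refine (prefixReach_mono x (Set.subset_insert q Y)).antisymm' ?_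
  rintro d ⟨⟨p, k⟩, hstart | ⟨rfl | hp, rfl⟩, hcd⟩
  · exact ⟨_, Or.inl hstart, hcd⟩
  · obtain ⟨c, hc, hcp⟩ := hq
    exact ⟨c, hc, hcp.trans hcd⟩
  · exact ⟨_, Or.inr ⟨hp, rfl⟩, hcd⟩

/-- The state in which a computation reads the last position of `x` before leaving `x` for the first
time is reachable anyway, so it never matters whether it is an entry. -/
theorem prefixMap_redundant_entry (A : TwoWayNFA α Q) (x : List α) :
    A.prefixMap x ∅ = ∅ ∨ ∃ q, ∀ Y, A.prefixMap x (insert q Y) = A.prefixMap x Y := by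
  refine (A.prefixMap x ∅).eq_empty_or_nonempty.imp_right ?_
  rintro ⟨r, c, hc, hcr⟩
  rcases hcr.cases_tail with heq | ⟨⟨q, k⟩, hcq, hk, hstep⟩
  · rcases hc with ⟨-, hc⟩ | ⟨hc, -⟩
    · simp [← heq] at hc
    · exact hc.elim
  · obtain rfl : k = x.length := hk.antisymm (Nat.succ_le_succ_iff.1 hstep.move_le_one.1)
    refine ⟨q, fun Y => ?_⟩
    have hq : (q, x.length) ∈ A.prefixReach x Y :=
      prefixReach_mono x (Set.empty_subset Y) ⟨c, hc, hcq⟩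
    rw [prefixMap, prefixReach_insert hq, prefixMap]

theorem reflTransGen_stepRel_of_prefixStep (h : ReflTransGen (A.PrefixStep x) c d) :
    ReflTransGen (A.StepRel (x ++ y)) c d :=
  h.lift id fun _ _ hstep => (stepRel_append_iff_of_le hstep.1).2 hstep.2

theorem reflTransGen_stepRel_of_suffixStep (h : ReflTransGen (A.SuffixStep y) c d) :
    ReflTransGen (A.StepRel (x ++ y)) (c.1, x.length + c.2) (d.1, x.length + d.2) := by
  refine h.lift (fun c => (c.1, x.length + c.2)) ?_
  rintro ⟨p, _ | k⟩ ⟨q, j⟩ ⟨hk, hstep⟩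
  · exact absurd hk (by simp)
  · exact stepRel_append_add_iff.2 hstep

/-- The states in which a computation on `x ++ y` can cross from `x` to `y` having returned
to `x` fewer than `i` times. -/
def crossings (A : TwoWayNFA α Q) (x y : List α) (i : ℕ) : Set Q :=
  (A.prefixMap x ∘ A.suffixMap y)^[i] ∅

theorem crossings_succ (i : ℕ) :
    A.crossings x y (i + 1) = A.prefixMap x (A.suffixMap y (A.crossings x y i)) :=
  Function.iterate_succ_apply' ..

theorem exists_reflTransGen_of_mem_crossings {i : ℕ} {r : Q} (hr : r ∈ A.crossings x y i) :
    ∃ s ∈ A.start, ReflTransGen (A.StepRel (x ++ y)) (s, 0) (r, x.length + 1) := by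
  induction i generalizing r with
  | zero => exact hr.elim
  | succ i ih =>
    rw [crossings_succ] at hr
    obtain ⟨⟨p, k⟩, ⟨hs, rfl⟩ | ⟨⟨r', hr', hrp⟩, rfl⟩, hpr⟩ := hr
    · exact ⟨p, hs, reflTransGen_stepRel_of_prefixStep hpr⟩
    · obtain ⟨s, hs, hsr⟩ := ih hr'
      exact ⟨s, hs, (hsr.trans (reflTransGen_stepRel_of_suffixStep hrp)).trans
        (reflTransGen_stepRel_of_prefixStep hpr)⟩

theorem mem_reach_of_reflTransGen {s : Q} (hs : s ∈ A.start)
    (h : ReflTransGen (A.StepRel (x ++ y)) (s, 0) d) :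
    (d.2 ≤ x.length ∧ ∃ i, d ∈ A.prefixReach x (A.suffixMap y (A.crossings x y i))) ∨
      ∃ k, d.2 = x.length + (k + 1) ∧ ∃ i, (d.1, k + 1) ∈ A.suffixReach y (A.crossings x y i) := by
  induction h with
  | refl => exact Or.inl ⟨Nat.zero_le _, 0, _, Or.inl ⟨hs, rfl⟩, .refl⟩
  | @tail c d _ hstep ih =>
    obtain ⟨q, j⟩ := d
    rcases ih with ⟨hc, i, c₀, hc₀, hcc⟩ | ⟨k, hk, i, r, hr, hrc⟩
    · have hreach : (q, j) ∈ A.prefixReach x (A.suffixMap y (A.crossings x y i)) :=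
        ⟨c₀, hc₀, hcc.tail ⟨hc, (stepRel_append_iff_of_le hc).1 hstep⟩⟩
      rcases le_or_gt j x.length with hj | hj
      · exact Or.inl ⟨hj, i, hreach⟩
      · obtain rfl : j = x.length + 1 := by
          have hjc : j ≤ c.2 + 1 := hstep.move_le_one.1
          omega
        exact Or.inr ⟨0, rfl, i + 1, q, crossings_succ (A := A) i ▸ hreach, .refl⟩
    · obtain ⟨p, l⟩ := c
      obtain rfl := hk
      obtain ⟨j, rfl⟩ : ∃ j', j = x.length + j' := Nat.exists_eq_add_of_le <| by
        have hkj : x.length + (k + 1) ≤ j + 1 := hstep.move_le_one.2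
        omega
      have hreach : (q, j) ∈ A.suffixReach y (A.crossings x y i) :=
        ⟨r, hr, hrc.tail ⟨Nat.le_add_left 1 k, stepRel_append_add_iff.1 hstep⟩⟩
      rcases j with _ | j
      · exact Or.inl ⟨le_rfl, i, (q, x.length), Or.inr ⟨hreach, rfl⟩, .refl⟩
      · exact Or.inr ⟨j, rfl, i, hreach⟩

theorem append_mem_language_iff :
    x ++ y ∈ A.language ↔
      ∃ i, ¬Disjoint ((A.prefixMap x ∘ A.suffixMap y)^[i] ∅) (A.acceptingEntries y) := by
  simp only [Set.not_disjoint_iff]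
  rw [mem_language_iff]
  constructor
  · rintro ⟨s, hs, f, hf, h⟩
    obtain ⟨hle, -⟩ | ⟨k, hk, i, r, hr, hrf⟩ := mem_reach_of_reflTransGen hs h
    · simp only [List.length_append] at hle
      omega
    · obtain rfl : k = y.length := by
        simp only [List.length_append] at hk
        omega
      exact ⟨i, r, hr, f, hf, hrf⟩
  · rintro ⟨i, r, hr, f, hf, hrf⟩
    obtain ⟨s, hs, hsr⟩ := exists_reflTransGen_of_mem_crossings hr
    refine ⟨s, hs, f, hf, ?_⟩
    rw [List.length_append, add_assoc]
    exact hsr.trans (reflTransGen_stepRel_of_suffixStep hrf)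

end Crossings

end TwoWayNFA

open Classical in
theorem mainTheorem2_general {K α Q ι κ : Type*} [Field K] [Fintype Q] [Finite ι] [Fintype κ]
    (A : TwoWayNFA α Q) (x : ι → List α) (y : κ → List α) :
    (Matrix.of fun i j => if x i ++ y j ∈ A.language then (1 : K) else 0).rank ≤
      ∑ k ∈ Finset.Icc 1 (Fintype.card Q),
        (k - 1).factorial * k.factorial * Nat.stirlingSecond (Fintype.card Q) k *
          Nat.stirlingSecond (Fintype.card Q + 1) k := by
  simp only [TwoWayNFA.append_mem_language_iff]
  exact rank_indicator_le (fun i => TwoWayNFA.prefixMap_mono (x i))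
    (fun j => TwoWayNFA.suffixMap_mono (y j)) (fun j => TwoWayNFA.suffixMap_empty (y j))
    fun i => A.prefixMap_redundant_entry (x i)

theorem mainTheorem2 {α Q : Type*} [Finite α] [Fintype Q] (n : ℕ) (hn : Fintype.card Q = n)
    (A : TwoWayNFA α Q) (L : Language α) (hL : A.language = L) {l m : ℕ}
    (x : Fin l → List α) (y : Fin m → List α) :
    (concatMatrix L x y).rank ≤
      ∑ k ∈ Finset.Icc 1 n,
        (k - 1).factorial * k.factorial * Nat.stirlingSecond n k *
          Nat.stirlingSecond (n + 1) k := by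
  subst hn hL
  exact mainTheorem2_general A x y
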